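/- Let $p$ be a prime number, let $H$ be a finite group of order prime to $p$, let $\gamma\ge 0$ be an integer, and let $F_\gamma$ be a free pro-$p$ group of rank $\gamma$, endowed with a continuous action of $H$ by automorphisms. For a simple $\mathbb F_p[H]$-module $\mathcal V$, view $\mathcal V$ as a discrete $F_\gamma\rtimes H$-module via the projection $F_\gamma\rtimes H\twoheadrightarrow H$, and put $$\delta_{\mathcal V}:=\dim_{\mathbb F_p}H^1(F_\gamma\rtimes H,\mathcal V),$$ where $H^1$ denotes continuous group cohomology. Let $P$ be a finite $p$-group endowed with an action of $H$ by automorphisms; similarly view $\mathcal V$ as a $P\rtimes H$-module via $P\rtimes H\twoheadrightarrow H$. Then the following assertions are equivalent: (i) there exists a continuous surjective $H$-equivariant group homomorphism $F_\gamma\twoheadrightarrow P$ (with $P$ discrete); (ii) for every simple $\mathbb F_p[H]$-module $\mathcal V$ one has $\dim_{\mathbb F_p}H^1(P\rtimes H,\mathcal V)\le\delta_{\mathcal V}$. -/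

import Mathlib

universe u

/-- A pro-`p` group: a profinite group (a compact, totally disconnected topological group) all of
whose open normal subgroups have `p`-power index. -/
structure IsProP (p : ℕ) (G : Type u) [Group G] [TopologicalSpace G] : Prop where
  isTopologicalGroup : IsTopologicalGroup G
  compactSpace : CompactSpace G
  totallyDisconnectedSpace : TotallyDisconnectedSpace G
  index_eq : ∀ U : OpenNormalSubgroup G, ∃ n : ℕ, (U : Subgroup G).index = p ^ n

/-- `F` is a free pro-`p` group of (finite) rank `γ`: it is a pro-`p` group with `γ` elements
`x₁, …, x_γ` such that every family of `γ` elements of a pro-`p` group `G` is the image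
of `x₁, …, x_γ` under a unique continuous homomorphism `F → G`. -/
structure IsFreeProP (p γ : ℕ) (F : Type u) [Group F] [TopologicalSpace F] : Prop where
  isProP : IsProP p F
  exists_basis : ∃ x : Fin γ → F,
    ∀ (G : Type u) [Group G] [TopologicalSpace G], IsProP p G →
      ∀ y : Fin γ → G, ∃! f : F →ₜ* G, ∀ i, f (x i) = y i

namespace SemidirectProduct

variable {N H : Type u} [Group N] [Group H] [TopologicalSpace N] [TopologicalSpace H]

/-- The product topology on a semidirect product. -/
instance instTopologicalSpaceSemidirect {φ : H →* MulAut N} : TopologicalSpace (N ⋊[φ] H) :=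
  TopologicalSpace.induced (fun a => (a.left, a.right)) inferInstance

theorem continuous_pair {φ : H →* MulAut N} :
    Continuous (fun a : N ⋊[φ] H => (a.left, a.right)) :=
  continuous_induced_dom

theorem continuous_left {φ : H →* MulAut N} : Continuous (fun a : N ⋊[φ] H => a.left) :=
  continuous_fst.comp continuous_pair

theorem continuous_right {φ : H →* MulAut N} : Continuous (fun a : N ⋊[φ] H => a.right) :=
  continuous_snd.comp continuous_pair

/-- The semidirect product attached to a continuous action is a topological group. -/
instance instIsTopologicalGroupSemidirect [MulDistribMulAction H N] [ContinuousSMul H N]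
    [IsTopologicalGroup N] [IsTopologicalGroup H] :
    IsTopologicalGroup (N ⋊[MulDistribMulAction.toMulAut H N] H) where
  continuous_mul := by
    refine continuous_induced_rng.2 ?_
    have hl := continuous_left (φ := MulDistribMulAction.toMulAut H N)
    have hr := continuous_right (φ := MulDistribMulAction.toMulAut H N)
    exact ((hl.comp continuous_fst).mul
      ((hr.comp continuous_fst).smul (hl.comp continuous_snd))).prodMk
      ((hr.comp continuous_fst).mul (hr.comp continuous_snd))
  continuous_inv := by
    refine continuous_induced_rng.2 ?_
    have hl := continuous_left (φ := MulDistribMulAction.toMulAut H N)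
    have hr := continuous_right (φ := MulDistribMulAction.toMulAut H N)
    exact (hr.inv.smul hl.inv).prodMk hr.inv

end SemidirectProduct

/-- An action of a discrete group on a discrete group is continuous. -/
instance instContinuousSMulOfDiscrete {H P : Type u} [Group H] [Group P]
    [TopologicalSpace H] [DiscreteTopology H] [TopologicalSpace P] [DiscreteTopology P]
    [MulDistribMulAction H P] : ContinuousSMul H P :=
  ⟨continuous_of_discreteTopology⟩

/-- A representation `ρ` of `H` on a discrete `𝔽_p`-vector space `V`, seen as a discrete
`N ⋊ H`-module over `𝔽_p` through the projection `N ⋊ H → H`. -/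
noncomputable def discreteInflation {p : ℕ} (N : Type u) {H V : Type u} [Group N] [Group H]
    [MulDistribMulAction H N] [AddCommGroup V] [Module (ZMod p) V] [TopologicalSpace V]
    [DiscreteTopology V] (ρ : Representation (ZMod p) H V) :
    TopRep.{u} (ZMod p) (N ⋊[MulDistribMulAction.toMulAut H N] H) :=
  haveI : ContinuousSMul (ZMod p) V := ⟨continuous_of_discreteTopology⟩
  TopRep.of
    { toMonoidHom :=
        { toFun := fun g => ⟨ρ g.right, continuous_of_discreteTopology⟩
          map_one' := by ext v; simp
          map_mul' := fun a b => by ext v; simp } }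

/-- `dim_{𝔽_p} H¹(N ⋊ H, V)`, where `H¹` is continuous group cohomology and `N ⋊ H` acts on the
discrete module `V` through the projection to `H`. -/
noncomputable def dimH1 {p : ℕ} (N : Type u) {H V : Type u} [Group N] [TopologicalSpace N]
    [IsTopologicalGroup N] [Group H] [TopologicalSpace H] [IsTopologicalGroup H]
    [MulDistribMulAction H N] [ContinuousSMul H N] [AddCommGroup V] [Module (ZMod p) V]
    [TopologicalSpace V] [DiscreteTopology V] (ρ : Representation (ZMod p) H V) : Cardinal.{u} :=
  Module.rank (ZMod p) (continuousCohomology 1 (discreteInflation N ρ))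

-- Since `|H|` is invertible in `𝔽_p`, restriction to `N` identifies `H¹(N ⋊ H, V)` with the
-- continuous `H`-equivariant homomorphisms `N → V`: `N` acts trivially on `V`, and a cocycle
-- vanishing on `N` comes from `H`, where averaging makes it a coboundary
-- (`nonempty_continuousCohomology_one_equiv_equivariantHoms`). Condition (ii) thus compares the
-- sizes of `Hom_H(P, V)` and `Hom_H(F, V)`, and (i) gives (ii) because composing with a surjection
-- is injective.
--
-- For the converse, let `Φ` be the Frattini subgroup of `P`. The quotient `P/Φ` is a finite
-- `𝔽_p[H]`-module, semisimple by Maschke, and `Hom_H(P/Φ, V)` embeds in `Hom_H(P, V)`. Hence `F`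
-- has at least as many equivariant homomorphisms to each simple module as `P/Φ` has. Adding simple
-- summands one at a time gives an equivariant surjection `F → P/Φ`
-- (`exists_surjective_equivariantHom`).
--
-- Freeness of `F` enters only in lifting this map to `P`. The universal property gives a lift that
-- need not be equivariant. When the kernel is central, averaging over `H` repairs it; the general
-- case follows by induction on the order (`IsFreeProP.exists_equivariant_lift`). The equivariant
-- lift is onto modulo `Φ`, hence onto, because `Φ` consists of non-generators.

universe v

/-! ### Continuous `H¹` through homogeneous cocycles -/

open CategoryTheory Limits in
/-- A linear map out of the cycles of a short complex of topological modules which is onto and whose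
kernel is the boundaries identifies the homology. -/
theorem TopModuleCat.nonempty_homology_linearEquiv {R : Type v} [Ring R] [TopologicalSpace R]
    (S : ShortComplex (TopModuleCat.{u} R)) {M : Type u} [AddCommGroup M] [Module R M]
    (θ : S.g.hom.ker →ₗ[R] M) (hθ : Function.Surjective θ)
    (hker : ∀ x, θ x = 0 ↔ ∃ y, S.f.hom y = (x : S.X₂)) :
    Nonempty (S.homology ≃ₗ[R] M) := by
  let D : S.LeftHomologyData :=
    ⟨_, _, _, _, _, TopModuleCat.isLimitKer _, by simp, TopModuleCat.isColimitCoker _⟩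
  have e : S.homology ≃ₗ[R] D.H :=
    ((forget₂ _ (ModuleCat R)).mapIso D.homologyIso).toLinearEquiv
  let l : S.X₁ →L[R] S.g.hom.ker := D.f'.hom
  have hl : ∀ y, (l y : S.X₂) = S.f.hom y := fun y =>
    congr($(D.f'_i).hom y)
  have hr : LinearMap.ker θ = LinearMap.range (l : S.X₁ →ₗ[R] S.g.hom.ker) := by
    ext x
    rw [LinearMap.mem_ker, hker]
    constructor
    · rintro ⟨y, hy⟩
      exact ⟨y, Subtype.ext ((hl y).trans hy)⟩
    · rintro ⟨y, rfl⟩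
      exact ⟨y, (hl y).symm⟩
  -- The chosen left homology data is the explicit topological kernel and cokernel, so the
  -- underlying module of `D.H` is this quotient by definition.
  have e' : D.H ≃ₗ[R] (S.g.hom.ker ⧸ LinearMap.range (l : S.X₁ →ₗ[R] S.g.hom.ker)) :=
    LinearEquiv.refl _ _
  exact ⟨e ≪≫ₗ e' ≪≫ₗ Submodule.quotEquivOfEq _ _ hr.symm ≪≫ₗ θ.quotKerEquivOfSurjective hθ⟩

namespace TopRep

variable {k : Type v} {G : Type u} [Ring k] [Group G] [TopologicalSpace k] [TopologicalSpace G]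
  [IsTopologicalGroup G] (X : TopRep.{u} k G)

theorem mem_invariants_coind₁ (τ : C(G, X)) :
    τ ∈ (resolutionX X 1).ρ.invariants ↔ ∀ g a, X.ρ g (τ (g⁻¹ * a)) = τ a := by
  rw [ContRepresentation.mem_invariants]
  exact forall_congr' fun g => ContinuousMap.ext_iff

theorem mem_invariants_coind₁_coind₁ (σ : C(G, C(G, X))) :
    σ ∈ (resolutionX X 2).ρ.invariants ↔
      ∀ g a b, X.ρ g (σ (g⁻¹ * a) (g⁻¹ * b)) = σ a b := by
  rw [ContRepresentation.mem_invariants]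
  exact forall_congr' fun g => ContinuousMap.ext_iff.trans
    (forall_congr' fun a => ContinuousMap.ext_iff)

/-- The homogeneous continuous `1`-cocycles. -/
def homogeneousOneCocycles : Submodule k C(G, C(G, X)) where
  carrier := {σ | (∀ g a b, X.ρ g (σ (g⁻¹ * a) (g⁻¹ * b)) = σ a b) ∧
    ∀ a b c, σ b c - (σ a c - σ a b) = 0}
  add_mem' {σ τ} hσ hτ := by
    refine ⟨fun g a b => ?_, fun a b c => ?_⟩
    · simp only [ContinuousMap.add_apply, map_add, hσ.1, hτ.1]
    · have h1 := hσ.2 a b c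
      have h2 := hτ.2 a b c
      simp only [ContinuousMap.add_apply]
      calc _ = (σ b c - (σ a c - σ a b)) + (τ b c - (τ a c - τ a b)) := by abel
        _ = 0 := by rw [h1, h2, add_zero]
  zero_mem' := by simp
  smul_mem' r σ hσ := by
    refine ⟨fun g a b => ?_, fun a b c => ?_⟩
    · simp only [ContinuousMap.smul_apply, map_smul, hσ.1]
    · simp only [ContinuousMap.smul_apply, ← smul_sub, hσ.2, smul_zero]

open CategoryTheory in
/-- A surjective linear map on homogeneous `1`-cocycles that vanishes exactly on coboundaries
computes `H¹`. -/
theorem nonempty_continuousCohomology_one_linearEquiv {M : Type u} [AddCommGroup M] [Module k M]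
    (θ : homogeneousOneCocycles X →ₗ[k] M) (hθ : Function.Surjective θ)
    (hker : ∀ σ, θ σ = 0 ↔ ∃ τ : C(G, X), (∀ g a, X.ρ g (τ (g⁻¹ * a)) = τ a) ∧
      ∀ a b, τ b - τ a = σ.1 a b) :
    Nonempty (continuousCohomology 1 X ≃ₗ[k] M) := by
  let K := homogeneousCochains X
  let S := K.sc' 0 1 2
  let e : K.homology 1 ≅ S.homology :=
    ShortComplex.homologyMapIso (K.isoSc' 0 1 2 (by simp) (by simp))
  have e' : continuousCohomology 1 X ≃ₗ[k] S.homology :=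
    ((forget₂ _ (ModuleCat k)).mapIso e).toLinearEquiv
  have hg : ∀ σ : S.X₂, S.g.hom σ = 0 ↔ (d X 2).hom σ.1 = 0 := fun σ => by
    rw [← homogeneousCochains.d_apply X 1 σ]
    exact Subtype.ext_iff
  let ι : S.g.hom.ker →ₗ[k] homogeneousOneCocycles X :=
    { toFun := fun σ => ⟨σ.1.1, (mem_invariants_coind₁_coind₁ X _).1 σ.1.2, fun a b c => by
        have := (hg σ.1).1 σ.2
        exact congr($this a b c)⟩
      map_add' := fun _ _ => rfl
      map_smul' := fun _ _ => rfl }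
  have hι : Function.Surjective ι := fun σ =>
    ⟨⟨⟨σ.1, (mem_invariants_coind₁_coind₁ X _).2 σ.2.1⟩, (hg _).2 <| by
      refine ContinuousMap.ext fun a => ContinuousMap.ext fun b => ContinuousMap.ext fun c => ?_
      exact σ.2.2 a b c⟩, rfl⟩
  obtain ⟨e''⟩ := TopModuleCat.nonempty_homology_linearEquiv S (θ ∘ₗ ι) (hθ.comp hι) (by
    intro σ
    rw [LinearMap.comp_apply, hker]
    constructor
    · rintro ⟨τ, h1, h2⟩
      refine ⟨⟨τ, (mem_invariants_coind₁ X _).2 h1⟩, Subtype.ext ?_⟩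
      refine (homogeneousCochains.d_apply X 0 _).trans ?_
      exact ContinuousMap.ext fun a => ContinuousMap.ext fun b => h2 a b
    · rintro ⟨τ, h⟩
      refine ⟨τ.1, (mem_invariants_coind₁ X _).1 τ.2, fun a b => ?_⟩
      have h' := (homogeneousCochains.d_apply X 0 τ).symm.trans congr(($h).1)
      exact congr($h' a b))
  exact ⟨e' ≪≫ₗ e''⟩

end TopRep

/-! ### `H¹(N ⋊ H, V)` as equivariant homomorphisms -/

section

variable {p : ℕ} (N : Type u) {H V : Type u} [Group N] [TopologicalSpace N]
  [IsTopologicalGroup N] [Group H] [TopologicalSpace H] [IsTopologicalGroup H]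
  [MulDistribMulAction H N] [ContinuousSMul H N] [AddCommGroup V] [Module (ZMod p) V]
  [TopologicalSpace V] [DiscreteTopology V] (ρ : Representation (ZMod p) H V)

/-- The continuous `H`-equivariant homomorphisms from `N` to the discrete `H`-module `V`. -/
def equivariantHoms : Submodule (ZMod p) (N → V) where
  carrier := {f | Continuous f ∧ (∀ a b, f (a * b) = f a + f b) ∧
    ∀ (h : H) a, f (h • a) = ρ h (f a)}
  add_mem' {f g} hf hg := by
    refine ⟨hf.1.add hg.1, fun a b => ?_, fun h a => ?_⟩
    · simp only [Pi.add_apply, hf.2.1, hg.2.1]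
      abel
    · simp only [Pi.add_apply, hf.2.2, hg.2.2, map_add]
  zero_mem' := ⟨continuous_const, by simp, by simp⟩
  smul_mem' r f hf := by
    refine ⟨(continuous_of_discreteTopology (f := fun v : V => r • v)).comp hf.1,
      fun a b => ?_, fun h a => ?_⟩
    · simp only [Pi.smul_apply, hf.2.1, smul_add]
    · simp only [Pi.smul_apply, hf.2.2, map_smul]

variable {N}

-- This is the degree-one part of inflation-restriction, with the cohomology of `H` killed by the
-- invertibility of `|H|`. The map sends a homogeneous cocycle `σ` to `n ↦ σ(1, n)`.
open TopRep in
theorem nonempty_continuousCohomology_one_equiv_equivariantHoms [Fact p.Prime] [Finite H]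
    [DiscreteTopology H] (hH : ¬ p ∣ Nat.card H) :
    Nonempty (continuousCohomology 1 (discreteInflation N ρ) ≃ₗ[ZMod p] equivariantHoms N ρ) := by
  let G := N ⋊[MulDistribMulAction.toMulAut H N] H
  have hl : Continuous (SemidirectProduct.left : G → N) := SemidirectProduct.continuous_left
  have hr : Continuous (SemidirectProduct.right : G → H) := SemidirectProduct.continuous_right
  have hinl : Continuous (SemidirectProduct.inl : N → G) :=
    continuous_induced_rng.2 (continuous_id.prodMk continuous_const)
  let X := discreteInflation N ρ
  have hρ : ∀ (a b : H) (v : V), ρ a (ρ b v) = ρ (a * b) v := fun a b v => by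
    rw [map_mul, Module.End.mul_apply]
  let Z := homogeneousOneCocycles X
  let ev : Z → G → G → V := fun σ a b => σ.1 a b
  have hinv : ∀ (σ : Z) (g a b : G), ρ g.right (ev σ (g⁻¹ * a) (g⁻¹ * b)) = ev σ a b :=
    fun σ => σ.2.1
  have hcoc : ∀ (σ : Z) (a b c : G), ev σ a c = ev σ a b + ev σ b c := fun σ a b c => by
    have h : ev σ b c - (ev σ a c - ev σ a b) = 0 := σ.2.2 a b c
    rw [← sub_eq_zero, ← neg_eq_zero, ← h]
    abel
  have hc : ∀ (σ : Z) (a b : G), ev σ 1 (a * b) = ev σ 1 a + ρ a.right (ev σ 1 b) :=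
    fun σ a b => by
      rw [hcoc σ 1 a (a * b), ← hinv σ a a (a * b), inv_mul_cancel, inv_mul_cancel_left]
  have hc1 : ∀ σ : Z, ev σ 1 1 = 0 := fun σ => by
    have := hc σ 1 1
    simpa using this
  let θ : Z →ₗ[ZMod p] equivariantHoms N ρ :=
    { toFun := fun σ => ⟨fun n => ev σ 1 (SemidirectProduct.inl n), by
        refine ⟨(σ.1 1).continuous.comp hinl, fun a b => ?_, fun h a => ?_⟩
        · change ev σ 1 _ = ev σ 1 _ + ev σ 1 _
          rw [map_mul, hc, SemidirectProduct.right_inl, map_one, Module.End.one_apply]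
        -- Equivariance: the action of `h` on `N` is conjugation in the semidirect product, and the
        -- contributions of `h` and `h⁻¹` to the cocycle cancel by `h2`.
        · have h1 : (SemidirectProduct.inl (h • a) : G) =
              SemidirectProduct.inr h * SemidirectProduct.inl a * SemidirectProduct.inr h⁻¹ :=
            SemidirectProduct.inl_aut (φ := MulDistribMulAction.toMulAut H N) h a
          have h2 := hc σ (SemidirectProduct.inr h) (SemidirectProduct.inr h⁻¹)
          rw [← map_mul, mul_inv_cancel, map_one, hc1] at h2
          change ev σ 1 _ = ρ h (ev σ 1 _)
          rw [h1, hc, hc]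
          simp only [SemidirectProduct.mul_right, SemidirectProduct.right_inr,
            SemidirectProduct.right_inl, mul_one] at h2 ⊢
          rw [add_right_comm, ← h2, zero_add]⟩
      map_add' := fun _ _ => rfl
      map_smul' := fun _ _ => rfl }
  refine nonempty_continuousCohomology_one_linearEquiv X θ ?_ ?_
  · rintro ⟨f, hf, hmul, hsmul⟩
    have hf1 : f 1 = 0 := by simpa using hmul 1 1
    have hfinv : ∀ a, f a⁻¹ = - f a := fun a => by
      rw [eq_neg_iff_add_eq_zero, ← hmul, inv_mul_cancel, hf1]
    -- The preimage of `f` is the differential of `τ`. Since `τ` itself need not be `G`-invariant,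
    -- this cocycle need not be a coboundary of invariant cochains.
    let τ : C(G, X) := ⟨fun g => f g.left, hf.comp hl⟩
    let σ : C(G, C(G, X)) := (d X 1).hom τ
    refine ⟨⟨σ, fun g a b => ?_, fun a b c => ?_⟩, Subtype.ext (funext fun n => ?_)⟩
    · have hg : ∀ a : G, f (g⁻¹ * a).left = ρ g.right⁻¹ (f a.left - f g.left) := fun a => by
        have : (g⁻¹ * a).left = g.right⁻¹ • (g.left⁻¹ * a.left) := by
          rw [smul_mul']; rfl
        rw [this, hsmul, hmul, hfinv, neg_add_eq_sub]
      change ρ g.right (f (g⁻¹ * b).left - f (g⁻¹ * a).left) = f b.left - f a.left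
      rw [hg, hg, ← map_sub, hρ, mul_inv_cancel, map_one, Module.End.one_apply,
        sub_sub_sub_cancel_right]
    · change f c.left - f b.left - (f c.left - f a.left - (f b.left - f a.left)) = 0
      abel
    · change f n - f 1 = f n
      rw [hf1, sub_zero]
  · intro σ
    have : Fintype H := Fintype.ofFinite H
    have hm : (Nat.card H : ZMod p) ≠ 0 := by
      rwa [Ne, ZMod.natCast_eq_zero_iff]
    constructor
    · intro h0
      have h0' : ∀ n : N, ev σ 1 (SemidirectProduct.inl n) = 0 := fun n => congr(($h0).1 n)
      let c : H → V := fun h => ev σ 1 (SemidirectProduct.inr h)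
      -- A cocycle vanishing on `N` is inflated from the cocycle `c` of `H`. Summing the cocycle
      -- identity over `H` gives `s = |H| • c k + ρ k s`, so `c` is the coboundary of `-s/|H|`.
      have hcg : ∀ g : G, ev σ 1 g = c g.right := fun g => by
        conv_lhs => rw [← SemidirectProduct.inl_left_mul_inr_right g, hc, h0']
        simp [c]
      have hcc : ∀ a b, c (a * b) = c a + ρ a (c b) := fun a b => by
        simp only [c, map_mul, hc, SemidirectProduct.right_inr]
      let s : V := ∑ h, c h
      have hs : ∀ k, s = (Nat.card H : ZMod p) • c k + ρ k s := fun k => by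
        have : s = ∑ h, c (k * h) := (Equiv.sum_comp (Equiv.mulLeft k) c).symm
        simp only [hcc, Finset.sum_add_distrib, Finset.sum_const, Finset.card_univ,
          ← map_sum] at this
        rw [Nat.card_eq_fintype_card, Nat.cast_smul_eq_nsmul]
        exact this
      let v : V := -((Nat.card H : ZMod p)⁻¹ • s)
      have hv : ∀ k, ρ k v - v = c k := fun k => by
        have h1 := hs k
        have h2 : s - ρ k s = (Nat.card H : ZMod p) • c k := by
          rw [sub_eq_iff_eq_add]; exact h1
        simp only [v, map_neg, map_smul, neg_sub_neg, ← smul_sub, h2, inv_smul_smul₀ hm]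
      refine ⟨⟨fun g => ρ g.right v,
        (continuous_of_discreteTopology (f := fun h : H => ρ h v)).comp hr⟩,
        fun g a => ?_, fun a b => ?_⟩
      · change ρ g.right (ρ (g⁻¹ * a).right v) = ρ a.right v
        rw [hρ, ← SemidirectProduct.mul_right, mul_inv_cancel_left]
      · change ρ b.right v - ρ a.right v = ev σ a b
        rw [← hinv σ a a b, inv_mul_cancel, hcg, ← hv, map_sub, hρ,
          ← SemidirectProduct.mul_right, mul_inv_cancel_left]
    · rintro ⟨τ, h1, h2⟩
      refine Subtype.ext (funext fun n => ?_)
      have h3 : ev σ 1 (SemidirectProduct.inl n) = τ (SemidirectProduct.inl n) - τ 1 :=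
        (h2 _ _).symm
      have h4 : ρ (SemidirectProduct.inl n : G).right (τ ((SemidirectProduct.inl n)⁻¹ *
        SemidirectProduct.inl n)) = τ (SemidirectProduct.inl n) := h1 _ _
      -- As `N` acts trivially on `V`, an invariant `τ` is constant on `N`, so its coboundary
      -- vanishes there.
      rw [inv_mul_cancel, SemidirectProduct.right_inl, map_one] at h4
      change ev σ 1 (SemidirectProduct.inl n) = 0
      rw [h3, ← h4]
      exact sub_self _

theorem dimH1_eq_rank_equivariantHoms [Fact p.Prime] [Finite H] [DiscreteTopology H]
    (hH : ¬ p ∣ Nat.card H) : dimH1 N ρ = Module.rank (ZMod p) (equivariantHoms N ρ) := by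
  obtain ⟨e⟩ := nonempty_continuousCohomology_one_equiv_equivariantHoms (N := N) ρ hH
  exact e.rank_eq

end

/-! ### Equivariant lifting along surjections of finite `p`-groups -/

section

theorem IsPGroup.isProP {p : ℕ} [Fact p.Prime] {Q : Type u} [Group Q] [Finite Q]
    [TopologicalSpace Q] [DiscreteTopology Q] (hQ : IsPGroup p Q) : IsProP p Q where
  isTopologicalGroup := inferInstance
  compactSpace := inferInstance
  totallyDisconnectedSpace := inferInstance
  index_eq _ := hQ.index _

/-- A nontrivial normal subgroup of a finite `p`-group meets the center. -/
theorem IsPGroup.inf_center_ne_bot {p : ℕ} [Fact p.Prime] {Q : Type u} [Group Q] [Finite Q]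
    (hQ : IsPGroup p Q) (N : Subgroup Q) [N.Normal] (hN : N ≠ ⊥) : N ⊓ Subgroup.center Q ≠ ⊥ := by
  have hC : IsPGroup p (ConjAct Q) := hQ.of_equiv ConjAct.toConjAct
  have hd : p ∣ Nat.card N := (hQ.to_subgroup N).card_eq_or_dvd.resolve_left fun h =>
    hN (Subgroup.card_eq_one.1 h)
  -- Under conjugation, the number of fixed points in `N` is divisible by `p`; since `1` is fixed,
  -- so is some other element.
  obtain ⟨b, hb, hb1⟩ := hC.exists_fixed_point_of_prime_dvd_card_of_fixed_point N hd
    (a := 1) (fun g => smul_one g)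
  intro h
  have hb' : (b : Q) ∈ N ⊓ Subgroup.center Q := by
    refine ⟨b.2, Subgroup.mem_center_iff.2 fun g => ?_⟩
    have := congrArg Subtype.val (hb (ConjAct.toConjAct g))
    rw [ConjAct.Subgroup.val_conj_smul, ConjAct.toConjAct_smul] at this
    rw [← mul_inv_eq_iff_eq_mul, this]
  rw [h, Subgroup.mem_bot] at hb'
  exact hb1 (Subtype.ext hb'.symm)

/-- The action induced on the quotient by a stable normal subgroup. -/
abbrev QuotientGroup.mulDistribMulActionOfStable {H Q : Type*} [Group H] [Group Q]
    [MulDistribMulAction H Q] (W : Subgroup Q) [W.Normal] (hW : ∀ (h : H), ∀ q ∈ W, h • q ∈ W) :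
    MulDistribMulAction H (Q ⧸ W) where
  smul h := QuotientGroup.map W W (MulDistribMulAction.toMonoidHom Q h) (hW h)
  one_smul x := by
    induction x using QuotientGroup.induction_on with
    | H q => exact congrArg (QuotientGroup.mk : Q → Q ⧸ W) (one_smul H q)
  mul_smul a b x := by
    induction x using QuotientGroup.induction_on with
    | H q => exact congrArg (QuotientGroup.mk : Q → Q ⧸ W) (mul_smul a b q)
  smul_mul h := map_mul (QuotientGroup.map W W (MulDistribMulAction.toMonoidHom Q h) (hW h))
  smul_one h := map_one (QuotientGroup.map W W (MulDistribMulAction.toMonoidHom Q h) (hW h))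

variable {p γ : ℕ} [Fact p.Prime] {H : Type u} [Group H] [Finite H]
  {F : Type u} [Group F] [TopologicalSpace F]

/-- Homomorphisms from a free pro-`p` group lift along surjections of finite `p`-groups. -/
theorem IsFreeProP.exists_lift (hF : IsFreeProP p γ F)
    {Q B : Type u} [Group Q] [Finite Q] [TopologicalSpace Q] [DiscreteTopology Q] [Group B]
    [TopologicalSpace B] [DiscreteTopology B]
    (hQ : IsPGroup p Q) (π : Q →* B) (hπ : Function.Surjective π) (g : F →ₜ* B) :
    ∃ f : F →ₜ* Q, ∀ x, π (f x) = g x := by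
  have : Finite B := Finite.of_surjective π hπ
  obtain ⟨x, hx⟩ := hF.exists_basis
  choose y hy using fun i => hπ (g (x i))
  obtain ⟨f, hf, -⟩ := hx Q hQ.isProP y
  let π' : Q →ₜ* B := ⟨π, continuous_of_discreteTopology⟩
  -- Both maps to `B` agree on the basis, so the uniqueness clause of freeness identifies them.
  have h := (hx B (hQ.of_surjective π hπ).isProP fun i => g (x i)).unique
    (y₁ := π'.comp f) (y₂ := g) (fun i => (congrArg π (hf i)).trans (hy i)) (fun i => rfl)
  exact ⟨f, fun a => congr($h a)⟩

variable [MulDistribMulAction H F]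

open scoped IsMulCommutative in
/-- Equivariant homomorphisms from a free pro-`p` group lift along central extensions of finite
`p`-groups: average a lift over `H`. -/
theorem IsFreeProP.exists_equivariant_lift_of_ker_le_center [TopologicalSpace H]
    [ContinuousSMul H F] (hF : IsFreeProP p γ F) (hH : ¬ p ∣ Nat.card H)
    {Q B : Type u} [Group Q] [Finite Q] [TopologicalSpace Q] [DiscreteTopology Q]
    [MulDistribMulAction H Q] [Group B]
    [TopologicalSpace B] [DiscreteTopology B] [MulDistribMulAction H B]
    (hQ : IsPGroup p Q) (π : Q →* B) (hπ : Function.Surjective π)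
    (hπH : ∀ (h : H) q, π (h • q) = h • π q) (hker : π.ker ≤ Subgroup.center Q)
    (g : F →ₜ* B) (hg : ∀ (h : H) x, g (h • x) = h • g x) :
    ∃ f : F →ₜ* Q, (∀ (h : H) x, f (h • x) = h • f x) ∧ ∀ x, π (f x) = g x := by
  obtain ⟨f₀, hf₀⟩ := hF.exists_lift hQ π hπ g
  have : Fintype H := Fintype.ofFinite H
  have hmem : ∀ (h : H) x, h • f₀ (h⁻¹ • x) * (f₀ x)⁻¹ ∈ π.ker := fun h x => by
    rw [MonoidHom.mem_ker, map_mul, hπH, hf₀, map_inv, hf₀, hg, smul_inv_smul, mul_inv_cancel]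
  -- The defect between the lift `f₀` and its twist `x ↦ h • f₀ (h⁻¹ • x)`. Both lift `g`, so it
  -- lies in the kernel; centrality makes it a homomorphism.
  let w : H → F →* Subgroup.center Q := fun h =>
    { toFun := fun x => ⟨h • f₀ (h⁻¹ • x) * (f₀ x)⁻¹, hker (hmem h x)⟩
      map_one' := by ext; simp
      map_mul' := fun a b => by
        ext
        have hb := Subgroup.mem_center_iff.1 (hker (hmem h b))
        simp only [smul_mul', map_mul, mul_inv_rev, Subgroup.coe_mul]
        calc _ = h • f₀ (h⁻¹ • a) * ((h • f₀ (h⁻¹ • b) * (f₀ b)⁻¹) * (f₀ a)⁻¹) := by group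
          _ = _ := by rw [← hb]; group }
  have hw : ∀ h x, ((w h x : Subgroup.center Q) : Q) * f₀ x = h • f₀ (h⁻¹ • x) := fun h x =>
    inv_mul_cancel_right _ _
  have hwc : ∀ h, Continuous (w h) := fun h => by
    refine Continuous.subtype_mk ?_ _
    refine Continuous.mul ?_ (f₀.continuous_toFun.inv)
    exact (continuous_of_discreteTopology (f := fun q : Q => h • q)).comp
      (f₀.continuous_toFun.comp (continuous_const_smul h⁻¹))
  let a : H → Subgroup.center Q →* Subgroup.center Q := fun k =>
    ((MulDistribMulAction.toMonoidHom Q k).comp (Subgroup.center Q).subtype).codRestrict _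
      fun z => Subgroup.mem_center_iff.2 fun q => by
        have := congrArg (k • ·) (Subgroup.mem_center_iff.1 z.2 (k⁻¹ • q))
        simpa [smul_mul'] using this
  have ha : ∀ k h x, a k (w h x) = w (k * h) (k • x) * (w k (k • x))⁻¹ := fun k h x => by
    rw [eq_mul_inv_iff_mul_eq]
    ext
    refine mul_right_cancel (b := f₀ (k • x)) ?_
    rw [hw, Subgroup.coe_mul, mul_assoc, hw]
    change k • ((w h x : Subgroup.center Q) : Q) * _ = _
    rw [← smul_mul', inv_smul_smul, hw, smul_smul, smul_smul, mul_inv_rev, inv_mul_cancel_right]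
  obtain ⟨n, hn⟩ := IsPGroup.iff_card.1 hQ
  -- The exponent `m` is an inverse of `|H|` modulo the order of the center, so `d` below is the
  -- mean of the defects `w h`, and `d * f₀` is the averaged lift.
  obtain ⟨m, hm⟩ : ∃ m : ℤ, ∀ z : Subgroup.center Q, (z ^ Nat.card H) ^ m = z := by
    have hco : (Nat.card Q).Coprime (Nat.card H) := by
      rw [hn]
      exact Nat.Coprime.pow_left _ ((Fact.out : p.Prime).coprime_iff_not_dvd.2 hH)
    have hco' : (Nat.card (Subgroup.center Q)).Coprime (Nat.card H) :=
      hco.coprime_dvd_left (Subgroup.card_subgroup_dvd_card _)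
    exact ⟨_, (powCoprime hco').left_inv⟩
  let d : F →* Subgroup.center Q := (∏ h, w h) ^ m
  have hd : ∀ x, d x = (∏ h, w h x) ^ m := fun x => by simp [d]
  have hdc : Continuous d := by
    have : (d : F → Subgroup.center Q) = fun x => (∏ h, w h x) ^ m := funext hd
    rw [this]
    exact (continuous_finsetProd _ fun h _ => hwc h).zpow m
  -- Applying `k` permutes the factors `w h` up to one copy of `(w k)⁻¹` each; the exponent `m`
  -- turns these `|H|` copies into one.
  have had : ∀ k x, a k (d x) = d (k • x) * (w k (k • x))⁻¹ := fun k x => by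
    rw [hd, hd, map_zpow, map_prod]
    simp only [ha, Finset.prod_mul_distrib, Finset.prod_const, Finset.card_univ]
    rw [mul_zpow, ← Nat.card_eq_fintype_card, hm]
    congr 2
    exact Equiv.prod_comp (Equiv.mulLeft k) fun h => w h (k • x)
  have hdker : ∀ x, ((d x : Subgroup.center Q) : Q) ∈ π.ker := fun x => by
    have : d x ∈ π.ker.comap (Subgroup.center Q).subtype := by
      rw [hd]
      exact zpow_mem (Subgroup.prod_mem _ fun h _ => hmem h x) _
    exact this
  refine ⟨⟨⟨⟨fun x => (d x : Q) * f₀ x, by simp⟩, fun x y => ?_⟩, ?_⟩, fun k x => ?_, fun x => ?_⟩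
  · have hy := Subgroup.mem_center_iff.1 (d y).2 (f₀ x)
    simp only [map_mul, Subgroup.coe_mul]
    rw [mul_assoc, mul_assoc, ← mul_assoc (f₀ x), hy, mul_assoc]
  · exact (continuous_subtype_val.comp hdc).mul f₀.continuous_toFun
  · change ((d (k • x) : Subgroup.center Q) : Q) * f₀ (k • x) =
      k • (((d x : Subgroup.center Q) : Q) * f₀ x)
    have h1 : k • ((d x : Subgroup.center Q) : Q) = ((a k (d x) : Subgroup.center Q) : Q) := rfl
    have h2 := hw k (k • x)
    rw [inv_smul_smul] at h2
    rw [smul_mul', h1, had, ← h2, ← mul_assoc, ← Subgroup.coe_mul, inv_mul_cancel_right]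
  · change π (((d x : Subgroup.center Q) : Q) * f₀ x) = g x
    rw [map_mul, MonoidHom.mem_ker.1 (hdker x), one_mul, hf₀]

/-- Equivariant homomorphisms from a free pro-`p` group lift along equivariant surjections of finite
`p`-groups. -/
theorem IsFreeProP.exists_equivariant_lift [TopologicalSpace H]
    [ContinuousSMul H F] (hF : IsFreeProP p γ F) (hH : ¬ p ∣ Nat.card H)
    {Q B : Type u} [Group Q] [Finite Q] [TopologicalSpace Q] [DiscreteTopology Q]
    [MulDistribMulAction H Q] [Group B]
    [TopologicalSpace B] [DiscreteTopology B] [MulDistribMulAction H B]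
    (hQ : IsPGroup p Q) (π : Q →* B) (hπ : Function.Surjective π)
    (hπH : ∀ (h : H) q, π (h • q) = h • π q)
    (g : F →ₜ* B) (hg : ∀ (h : H) x, g (h • x) = h • g x) :
    ∃ f : F →ₜ* Q, (∀ (h : H) x, f (h • x) = h • f x) ∧ ∀ x, π (f x) = g x := by
  induction hn : Nat.card Q using Nat.strong_induction_on generalizing Q with
  | _ n ih =>
  by_cases hker : π.ker = ⊥
  · exact hF.exists_equivariant_lift_of_ker_le_center hH hQ π hπ hπH (hker ▸ bot_le) g hg
  -- Lift first to the smaller group `Q ⧸ W` by induction, then across the central extension `Q → Q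
  -- ⧸ W`.
  let W : Subgroup Q := π.ker ⊓ Subgroup.center Q
  have hWne : W ≠ ⊥ := hQ.inf_center_ne_bot _ hker
  have hW : ∀ (h : H), ∀ q ∈ W, h • q ∈ W := fun h q hq => by
    refine ⟨?_, Subgroup.mem_center_iff.2 fun r => ?_⟩
    · change π _ = 1
      rw [hπH, MonoidHom.mem_ker.1 hq.1, smul_one]
    · have := congrArg (h • ·) (Subgroup.mem_center_iff.1 hq.2 (h⁻¹ • r))
      simpa [smul_mul'] using this
  let := QuotientGroup.mulDistribMulActionOfStable W hW
  have hcard : Nat.card (Q ⧸ W) < n := by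
    rw [← hn, Subgroup.card_eq_card_quotient_mul_card_subgroup W]
    exact lt_mul_of_one_lt_right Nat.card_pos ((Subgroup.one_lt_card_iff_ne_bot _).2 hWne)
  have : DiscreteTopology (Q ⧸ W) := QuotientGroup.discreteTopology (isOpen_discrete _)
  let π' : Q ⧸ W →* B := QuotientGroup.lift W π fun q hq => hq.1
  obtain ⟨f', hf'H, hf'⟩ := ih _ hcard (hQ.to_quotient W) π'
    (QuotientGroup.lift_surjective_of_surjective W π hπ _) (fun h q => by
      induction q using QuotientGroup.induction_on with
      | H q => exact hπH h q) rfl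
  obtain ⟨f, hfH, hf⟩ := hF.exists_equivariant_lift_of_ker_le_center hH hQ (QuotientGroup.mk' W)
    (QuotientGroup.mk'_surjective W) (fun h q => rfl)
    (by rw [QuotientGroup.ker_mk']; exact inf_le_right) f' hf'H
  exact ⟨f, hfH, fun x => by rw [← hf', ← hf]; rfl⟩

end

/-! ### Semisimple equivariant quotients of `F` -/

section

theorem Subrepresentation.isIrreducible_toRepresentation_of_isAtom {k G V : Type*} [Field k]
    [Monoid G] [AddCommGroup V] [Module k V] {ρ : Representation k G V} {S : Subrepresentation ρ}
    (hS : IsAtom S) : S.toRepresentation.IsIrreducible := by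
  have hne : ∃ v : S.toSubmodule, v ≠ 0 := by
    by_contra! h
    refine hS.1 (Subrepresentation.toSubmodule_injective ?_)
    exact (Submodule.eq_bot_iff _).2 fun v hv => congrArg Subtype.val (h ⟨v, hv⟩)
  refine { exists_pair_ne := ⟨⊥, ⊤, fun h => ?_⟩, eq_bot_or_eq_top := fun U => ?_ }
  · obtain ⟨v, hv⟩ := hne
    have h' : (⊥ : Submodule k S.toSubmodule) = ⊤ := congrArg Subrepresentation.toSubmodule h
    exact hv ((Submodule.mem_bot k).1 (h' ▸ Submodule.mem_top))
  · let U' : Subrepresentation ρ := ⟨U.toSubmodule.map S.toSubmodule.subtype, by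
      rintro g _ ⟨v, hv, rfl⟩
      exact ⟨_, U.apply_mem_toSubmodule g hv, rfl⟩⟩
    have hU' : U' ≤ S := by
      rintro _ ⟨v, -, rfl⟩
      exact v.2
    rcases hS.le_iff.1 hU' with h | h
    · left
      refine Subrepresentation.toSubmodule_injective ?_
      refine (Submodule.eq_bot_iff _).2 fun v hv => Subtype.ext ?_
      have : (v : V) ∈ U' := ⟨v, hv, rfl⟩
      rw [h] at this
      exact (Submodule.mem_bot k).1 this
    · right
      refine Subrepresentation.toSubmodule_injective ?_
      refine (Submodule.eq_top_iff').2 fun v => ?_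
      have hv : (v : V) ∈ U'.toSubmodule := by
        rw [h]
        exact v.2
      obtain ⟨w, hw, hwv⟩ := hv
      rwa [← Subtype.ext hwv]

open Representation

/-- The projection onto a subrepresentation along a complement. -/
noncomputable def Subrepresentation.projection {k G V : Type*} [Field k]
    [Monoid G] [AddCommGroup V] [Module k V] {ρ : Representation k G V} {S T : Subrepresentation ρ}
    (h : IsCompl S.toSubmodule T.toSubmodule) : IntertwiningMap ρ S.toRepresentation :=
  LinearMap.intertwiningMap_of_isIntertwiningMap _ _
    (Submodule.projectionOnto S.toSubmodule T.toSubmodule h) fun g v => by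
      obtain ⟨s, hs, t, ht, rfl⟩ := Submodule.mem_sup.1 (h.sup_eq_top ▸ Submodule.mem_top (x := v))
      lift s to S.toSubmodule using hs
      rw [map_add, map_add, map_add, Submodule.projectionOnto_apply_left,
        Submodule.projectionOnto_apply_of_mem_right h ht,
        Submodule.projectionOnto_apply_of_mem_right h (T.apply_mem_toSubmodule g ht),
        add_zero, add_zero]
      exact Submodule.projectionOnto_apply_left h (S.toRepresentation g s)

theorem Subrepresentation.projection_apply_left {k G V : Type*} [Field k]
    [Monoid G] [AddCommGroup V] [Module k V] {ρ : Representation k G V} {S T : Subrepresentation ρ}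
    (h : IsCompl S.toSubmodule T.toSubmodule) (s : S.toSubmodule) :
    Subrepresentation.projection h s = s :=
  Submodule.projectionOnto_apply_left h s

theorem Subrepresentation.projection_apply_of_mem_right {k G V : Type*} [Field k]
    [Monoid G] [AddCommGroup V] [Module k V] {ρ : Representation k G V} {S T : Subrepresentation ρ}
    (h : IsCompl S.toSubmodule T.toSubmodule) {t : V} (ht : t ∈ T.toSubmodule) :
    Subrepresentation.projection h t = 0 :=
  Submodule.projectionOnto_apply_of_mem_right h ht

/-- Precomposition with an intertwining map, as a linear map. -/
def Representation.IntertwiningMap.precomp {k G U V W : Type*} [Field k] [Monoid G]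
    [AddCommGroup U] [Module k U] [AddCommGroup V] [Module k V] [AddCommGroup W] [Module k W]
    {σ : Representation k G U} {τ : Representation k G V} (π : IntertwiningMap σ τ)
    (ρ : Representation k G W) : IntertwiningMap τ ρ →ₗ[k] IntertwiningMap σ ρ where
  toFun φ := φ.comp π
  map_add' _ _ := rfl
  map_smul' _ _ := rfl

theorem Representation.IntertwiningMap.precomp_injective {k G U V W : Type*} [Field k] [Monoid G]
    [AddCommGroup U] [Module k U] [AddCommGroup V] [Module k V] [AddCommGroup W] [Module k W]
    {σ : Representation k G U} {τ : Representation k G V} (π : IntertwiningMap σ τ)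
    (hπ : Function.Surjective π) (ρ : Representation k G W) :
    Function.Injective (π.precomp ρ) := fun φ ψ h => by
  refine DFunLike.ext _ _ fun v => ?_
  obtain ⟨u, rfl⟩ := hπ v
  exact congr($h u)

variable {p : ℕ} [Fact p.Prime] {H F : Type u} [Group H] [Group F] [TopologicalSpace F]
  [MulDistribMulAction H F]

/-- Composing an equivariant homomorphism with an intertwining map. -/
def equivariantHoms.compIntertwining {T V : Type u} [AddCommGroup T] [Module (ZMod p) T] [TopologicalSpace T]
    [DiscreteTopology T] [AddCommGroup V] [Module (ZMod p) V] [TopologicalSpace V]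
    [DiscreteTopology V] {τ : Representation (ZMod p) H T} (f : equivariantHoms F τ)
    (ρ : Representation (ZMod p) H V) : IntertwiningMap τ ρ →ₗ[ZMod p] equivariantHoms F ρ where
  toFun φ := ⟨fun x => φ (f.1 x),
    (continuous_of_discreteTopology (f := φ)).comp f.2.1,
    fun a b => (congrArg φ (f.2.2.1 a b)).trans (map_add φ _ _),
    fun h a => (congrArg φ (f.2.2.2 h a)).trans (IntertwiningMap.isIntertwining _ _ φ h _)⟩
  map_add' _ _ := rfl
  map_smul' _ _ := rfl

/-- If `f` is onto and `g` vanishes where `f` does, then `g` factors through `f`. -/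
theorem equivariantHoms.exists_comp_eq {T V : Type u} [AddCommGroup T] [Module (ZMod p) T]
    [TopologicalSpace T] [DiscreteTopology T] [AddCommGroup V] [Module (ZMod p) V]
    [TopologicalSpace V] [DiscreteTopology V] {τ : Representation (ZMod p) H T}
    {ρ : Representation (ZMod p) H V} (f : equivariantHoms F τ) (hf : Function.Surjective f.1)
    (g : equivariantHoms F ρ) (hfg : ∀ x, f.1 x = 0 → g.1 x = 0) : ∃ φ, equivariantHoms.compIntertwining f ρ φ = g := by
  have hinv : ∀ {W : Type u} [AddCommGroup W] [Module (ZMod p) W] [TopologicalSpace W]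
      [DiscreteTopology W] {ω : Representation (ZMod p) H W} (e : equivariantHoms F ω) (a b : F),
      e.1 (a * b⁻¹) = e.1 a - e.1 b := fun e a b => by
    rw [eq_sub_iff_add_eq, ← e.2.2.1, inv_mul_cancel_right]
  have key : ∀ x y, f.1 x = f.1 y → g.1 x = g.1 y := fun x y h => by
    rw [← sub_eq_zero, ← hinv] at h ⊢
    exact hfg _ h
  have hs := Function.surjInv_eq hf
  let φ₀ : T →+ V :=
    AddMonoidHom.mk' (fun t => g.1 (Function.surjInv hf t)) fun a b => by
      rw [← g.2.2.1]
      exact key _ _ (by rw [hs, f.2.2.1, hs, hs])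
  let φ : IntertwiningMap τ ρ :=
    LinearMap.intertwiningMap_of_isIntertwiningMap _ _ (φ₀.toZModLinearMap p) fun h t => by
      change g.1 _ = ρ h (g.1 _)
      rw [← g.2.2.2]
      exact key _ _ (by rw [hs, f.2.2.2, hs])
  refine ⟨φ, Subtype.ext (funext fun x => ?_)⟩
  change g.1 (Function.surjInv hf (f.1 x)) = g.1 x
  exact key _ _ (hs _)

/-- A finite `𝔽_p[H]`-module `B` is an equivariant quotient of `F` as soon as, for every simple
module, there are at least as many equivariant homomorphisms from `F` as from `B`. -/
theorem exists_surjective_equivariantHom [Finite H] (hH : ¬ p ∣ Nat.card H) {B : Type u} [AddCommGroup B]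
    [Module (ZMod p) B] [TopologicalSpace B] [DiscreteTopology B] [Finite B]
    (σ : Representation (ZMod p) H B)
    (hσ : ∀ (V : Type u) [AddCommGroup V] [Module (ZMod p) V] [TopologicalSpace V]
      [DiscreteTopology V] (ρ : Representation (ZMod p) H V), ρ.IsIrreducible →
      Module.rank (ZMod p) (IntertwiningMap σ ρ) ≤ Module.rank (ZMod p) (equivariantHoms F ρ)) :
    ∃ f : equivariantHoms F σ, Function.Surjective f.1 := by
  induction hn : Nat.card B using Nat.strong_induction_on generalizing B with
  | _ n ih =>
  rcases subsingleton_or_nontrivial B with hB | hB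
  · exact ⟨0, fun b => ⟨1, Subsingleton.elim _ _⟩⟩
  have : Finite (Subrepresentation σ) := Finite.of_injective _ SetLike.coe_injective
  have hbt : (⊥ : Subrepresentation σ) ≠ ⊤ := fun h =>
    bot_ne_top (α := Submodule (ZMod p) B) (congrArg Subrepresentation.toSubmodule h)
  obtain ⟨S, hS, -⟩ := (eq_bot_or_exists_atom_le (⊤ : Subrepresentation σ)).resolve_left hbt.symm
  -- This instance is what Maschke's theorem needs to supply a complement of `S`.
  have : NeZero (Nat.card H : ZMod p) := ⟨by rwa [Ne, ZMod.natCast_eq_zero_iff]⟩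
  obtain ⟨T, hST⟩ := exists_isCompl S
  have hST' : IsCompl S.toSubmodule T.toSubmodule :=
    IsCompl.of_eq (congrArg Subrepresentation.toSubmodule hST.inf_eq_bot)
      (congrArg Subrepresentation.toSubmodule hST.sup_eq_top)
  have hSirr := Subrepresentation.isIrreducible_toRepresentation_of_isAtom hS
  obtain ⟨s₀, hs₀⟩ : ∃ s : S.toSubmodule, s ≠ 0 := by
    by_contra! h
    refine hS.1 (Subrepresentation.toSubmodule_injective ?_)
    exact (Submodule.eq_bot_iff _).2 fun v hv => congrArg Subtype.val (h ⟨v, hv⟩)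
  let πT := Subrepresentation.projection hST'.symm
  let πS := Subrepresentation.projection hST'
  have hπT : Function.Surjective πT := fun t =>
    ⟨t, Subrepresentation.projection_apply_left hST'.symm t⟩
  have hcard : Nat.card T.toSubmodule < n := by
    rw [← hn]
    refine Finite.card_subtype_lt (x := (s₀ : B)) fun h => hs₀ (Subtype.ext ?_)
    exact Submodule.disjoint_def.1 hST'.disjoint _ s₀.2 h
  obtain ⟨f, hf⟩ := ih _ hcard T.toRepresentation (fun V _ _ _ _ ρ hρ =>
    (LinearMap.rank_le_of_injective _ (πT.precomp_injective hπT ρ)).trans (hσ V ρ hρ)) rfl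
  -- If every map `F → S` factored through `f`, the rank hypothesis would give `dim Hom(B, S) ≤ dim
  -- Hom(T, S)`. Precomposition with `πT` would then be onto, and `πS` would factor through `πT`,
  -- which kills `S`.
  obtain ⟨g, hg⟩ : ∃ g : equivariantHoms F S.toRepresentation,
      ∀ φ, equivariantHoms.compIntertwining f S.toRepresentation φ ≠ g := by
    by_contra! h
    have hle := (hσ _ S.toRepresentation hSirr).trans (LinearMap.rank_le_of_surjective _ h)
    have hinj := πT.precomp_injective hπT S.toRepresentation
    have hle' := LinearMap.rank_le_of_injective _ hinj
    have hfin : ∀ {U W : Type u} [AddCommGroup U] [Module (ZMod p) U] [AddCommGroup W]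
        [Module (ZMod p) W] [Finite U] [Finite W] (μ : Representation (ZMod p) H U)
        (ν : Representation (ZMod p) H W), Module.Finite (ZMod p) (IntertwiningMap μ ν) :=
      fun μ ν =>
        have : Finite (IntertwiningMap μ ν) := Finite.of_injective _ DFunLike.coe_injective
        inferInstance
    have := hfin σ S.toRepresentation
    have := hfin T.toRepresentation S.toRepresentation
    have heq : Module.finrank (ZMod p) (IntertwiningMap T.toRepresentation S.toRepresentation) =
        Module.finrank (ZMod p) (IntertwiningMap σ S.toRepresentation) :=
      congrArg Cardinal.toNat (le_antisymm hle' hle)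
    obtain ⟨φ, hφ⟩ := (LinearMap.injective_iff_surjective_of_finrank_eq_finrank heq).1 hinj πS
    have h1 : πS s₀ = φ (πT s₀) := congr(($hφ.symm) s₀)
    have h2 : πS s₀ = s₀ := Subrepresentation.projection_apply_left hST' s₀
    have h3 : πT s₀ = 0 := Subrepresentation.projection_apply_of_mem_right hST'.symm s₀.2
    rw [h2, h3, map_zero] at h1
    exact hs₀ h1
  let ι : ∀ U : Subrepresentation σ, IntertwiningMap U.toRepresentation σ := fun U =>
    LinearMap.intertwiningMap_of_isIntertwiningMap _ _ U.toSubmodule.subtype fun _ _ => rfl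
  let e : equivariantHoms F σ := equivariantHoms.compIntertwining f σ (ι T) + equivariantHoms.compIntertwining g σ (ι S)
  have he : ∀ x, e.1 x = (f.1 x : B) + (g.1 x : B) := fun x => by
    change (f.1 x : B) + (g.1 x : B) = _
    rfl
  have he1 : e.1 1 = 0 := by simpa using e.2.2.1 1 1
  let M : AddSubgroup B :=
    { carrier := Set.range e.1
      zero_mem' := ⟨1, he1⟩
      add_mem' := by
        rintro _ _ ⟨x, rfl⟩ ⟨y, rfl⟩
        exact ⟨x * y, e.2.2.1 x y⟩
      neg_mem' := by
        rintro _ ⟨x, rfl⟩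
        exact ⟨x⁻¹, by rw [eq_neg_iff_add_eq_zero, ← e.2.2.1, inv_mul_cancel, he1]⟩ }
  -- `K` is the part of `S` inside the image of `e = f + g`. If `K = ⊥`, then `g` vanishes wherever
  -- `f` does and so factors through `f`, which was excluded. If `K = ⊤`, the image contains `S` and
  -- surjects onto `T`.
  let K : Subrepresentation S.toRepresentation :=
    ⟨(AddSubgroup.toZModSubmodule p M).comap S.toSubmodule.subtype, by
      rintro h v ⟨x, hx⟩
      exact ⟨h • x, (e.2.2.2 h x).trans congr(σ h $hx)⟩⟩
  refine ⟨e, fun b => ?_⟩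
  rcases hSirr.eq_bot_or_eq_top K with hK | hK
  · obtain ⟨φ, hφ⟩ := equivariantHoms.exists_comp_eq f hf g fun x hx => by
      have : g.1 x ∈ K.toSubmodule := ⟨x, by rw [he, hx]; exact zero_add _⟩
      rw [hK] at this
      exact (Submodule.mem_bot _).1 this
    exact absurd hφ (hg φ)
  · have hSM : ∀ s : S.toSubmodule, (s : B) ∈ M := fun s => by
      have : s ∈ K.toSubmodule := by rw [hK]; exact Submodule.mem_top
      exact this
    obtain ⟨t, ht, s, hs, rfl⟩ :=
      Submodule.mem_sup.1 (hST'.symm.sup_eq_top ▸ Submodule.mem_top (x := b))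
    obtain ⟨x, hx⟩ := hf ⟨t, ht⟩
    have h1 : t + s = e.1 x + ((⟨s, hs⟩ - g.1 x : S.toSubmodule) : B) := by
      rw [he, hx, Submodule.coe_sub]
      abel
    rw [h1]
    exact M.add_mem ⟨x, rfl⟩ (hSM _)

end

/-! ### The Frattini quotient as an `𝔽_p[H]`-module -/

section

open Representation

/-- By Sylow, a proper subgroup of order `p ^ k` lies in one of order `p ^ (k + 1)`, which
maximality forces to be the whole group. -/
theorem IsPGroup.index_eq_of_isCoatom {p : ℕ} [Fact p.Prime] {P : Type u} [Group P] [Finite P]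
    (hP : IsPGroup p P) {K : Subgroup P} (hK : IsCoatom K) : K.index = p := by
  obtain ⟨m, hm⟩ := IsPGroup.iff_card.1 hP
  obtain ⟨k, hk⟩ := IsPGroup.iff_card.1 (hP.to_subgroup K)
  have hp : p.Prime := Fact.out
  have hlt : Nat.card K < Nat.card P :=
    lt_of_le_of_ne (Subgroup.card_le_card_group K) fun h => hK.1 (Subgroup.eq_top_of_card_eq K h)
  rw [hk, hm] at hlt
  have hkm : k + 1 ≤ m := (Nat.pow_lt_pow_iff_right hp.one_lt).1 hlt
  obtain ⟨K', hK', hKK'⟩ := Sylow.exists_subgroup_card_pow_succ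
    (hm ▸ pow_dvd_pow p hkm : p ^ (k + 1) ∣ Nat.card P) hk
  have hne : K ≠ K' := by
    rintro rfl
    rw [hk] at hK'
    exact (Nat.lt_succ_self k).ne (Nat.pow_right_injective hp.two_le hK')
  have htop : K' = ⊤ := hK.2 _ (lt_of_le_of_ne hKK' hne)
  have hcard : Nat.card P = p ^ (k + 1) := by rw [← hK', htop, Subgroup.card_top]
  have h := K.card_mul_index
  rw [hcard, hk, pow_succ] at h
  exact Nat.eq_of_mul_eq_mul_left (pow_pos hp.pos k) h

theorem IsPGroup.normal_of_isCoatom {p : ℕ} [Fact p.Prime] {P : Type u} [Group P] [Finite P]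
    (hP : IsPGroup p P) {K : Subgroup P} (hK : IsCoatom K) : K.Normal :=
  have := hP.isNilpotent
  Subgroup.NormalizerCondition.normal_of_coatom K Group.normalizerCondition_of_isNilpotent hK

theorem mem_frattini_iff {G : Type*} [Group G] {x : G} :
    x ∈ frattini G ↔ ∀ K : Subgroup G, IsCoatom K → x ∈ K := by
  simp [frattini, Order.radical, Subgroup.mem_iInf]

/-- Each maximal subgroup is normal of index `p`, so its quotient is cyclic of order `p` and kills
`p`-th powers and commutators. Their intersection is the Frattini subgroup, whose quotient is
therefore an `𝔽_p`-vector space. -/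
theorem IsPGroup.frattini_quotient_pow_eq_one {p : ℕ} [Fact p.Prime] {P : Type u} [Group P]
    [Finite P] (hP : IsPGroup p P) (x : P ⧸ frattini P) : x ^ p = 1 := by
  induction x using QuotientGroup.induction_on with
  | H x =>
  rw [← QuotientGroup.mk_pow, QuotientGroup.eq_one_iff, mem_frattini_iff]
  intro K hK
  have := hP.normal_of_isCoatom hK
  rw [← QuotientGroup.eq_one_iff, QuotientGroup.mk_pow, ← hP.index_eq_of_isCoatom hK]
  exact pow_card_eq_one'

theorem IsPGroup.frattini_quotient_mul_comm {p : ℕ} [Fact p.Prime] {P : Type u} [Group P]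
    [Finite P] (hP : IsPGroup p P) (x y : P ⧸ frattini P) : x * y = y * x := by
  induction x using QuotientGroup.induction_on with
  | H x =>
  induction y using QuotientGroup.induction_on with
  | H y =>
  rw [← QuotientGroup.mk_mul, ← QuotientGroup.mk_mul, QuotientGroup.eq, mem_frattini_iff]
  intro K hK
  have := hP.normal_of_isCoatom hK
  rw [← QuotientGroup.eq, QuotientGroup.mk_mul, QuotientGroup.mk_mul]
  have : IsCyclic (P ⧸ K) := isCyclic_of_prime_card (hP.index_eq_of_isCoatom hK)
  exact IsCyclic.commGroup.mul_comm _ _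

variable {p : ℕ} {H : Type u} [Group H]

/-- Equivariant homomorphisms pull back injectively along equivariant surjections. -/
theorem rank_equivariantHoms_le_of_surjective [Fact p.Prime] {N M V : Type u} [Group N]
    [TopologicalSpace N] [MulDistribMulAction H N] [Group M] [TopologicalSpace M]
    [MulDistribMulAction H M] [AddCommGroup V] [Module (ZMod p) V] [TopologicalSpace V]
    [DiscreteTopology V] (ρ : Representation (ZMod p) H V) (f : N →ₜ* M)
    (hfH : ∀ (h : H) x, f (h • x) = h • f x) (hf : Function.Surjective f) :
    Module.rank (ZMod p) (equivariantHoms M ρ) ≤ Module.rank (ZMod p) (equivariantHoms N ρ) := by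
  let l : equivariantHoms M ρ →ₗ[ZMod p] equivariantHoms N ρ :=
    { toFun := fun φ => ⟨fun x => φ.1 (f x), φ.2.1.comp f.continuous_toFun,
        fun a b => (congrArg φ.1 (map_mul f a b)).trans (φ.2.2.1 _ _),
        fun h a => (congrArg φ.1 (hfH h a)).trans (φ.2.2.2 _ _)⟩
      map_add' := fun _ _ => rfl
      map_smul' := fun _ _ => rfl }
  refine LinearMap.rank_le_of_injective l fun φ ψ h => Subtype.ext (funext fun y => ?_)
  obtain ⟨x, rfl⟩ := hf y
  exact congr(($h).1 x)

/-- An elementary abelian `p`-group with `H`-action, written additively as `B`, is an equivariant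
quotient of `F` as soon as, for every simple module, `F` has at least as many equivariant
homomorphisms to it. -/
theorem exists_surjective_of_mulEquiv_multiplicative [Fact p.Prime] [Finite H]
    (hH : ¬ p ∣ Nat.card H) {F Q B : Type u} [Group F] [TopologicalSpace F]
    [MulDistribMulAction H F] [Group Q] [Finite Q] [TopologicalSpace Q] [DiscreteTopology Q]
    [MulDistribMulAction H Q] [AddCommGroup B] [Module (ZMod p) B] (β : Q ≃* Multiplicative B)
    (hrank : ∀ (V : Type u) [AddCommGroup V] [Module (ZMod p) V] [TopologicalSpace V]
      [DiscreteTopology V] (ρ : Representation (ZMod p) H V), ρ.IsIrreducible →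
      Module.rank (ZMod p) (equivariantHoms Q ρ) ≤ Module.rank (ZMod p) (equivariantHoms F ρ)) :
    ∃ g : F →ₜ* Q, (∀ (h : H) x, g (h • x) = h • g x) ∧ Function.Surjective g := by
  let : TopologicalSpace B := ⊥
  have : DiscreteTopology B := ⟨rfl⟩
  let b : Q → B := fun q => (β q).toAdd
  let c : B → Q := fun x => β.symm (Multiplicative.ofAdd x)
  have hbc : ∀ x, b (c x) = x := fun x => congrArg Multiplicative.toAdd (β.apply_symm_apply _)
  have hcb : ∀ q, c (b q) = q := fun q => β.symm_apply_apply q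
  have hb : ∀ q r, b (q * r) = b q + b r := fun q r => congrArg Multiplicative.toAdd (map_mul β q r)
  have hc : ∀ x y, c (x + y) = c x * c y := fun x y => map_mul β.symm _ _
  have : Finite B := Finite.of_injective c fun x y h => by rw [← hbc x, h, hbc]
  let e : H → Module.End (ZMod p) B := fun h =>
    (AddMonoidHom.mk' (fun x => b (h • c x)) fun x y => by
      rw [hc, smul_mul', hb]).toZModLinearMap p
  have hex : ∀ h x, e h x = b (h • c x) := fun _ _ => rfl
  let σ : Representation (ZMod p) H B :=
    ⟨⟨e, LinearMap.ext fun x => by rw [hex, one_smul, hbc, Module.End.one_apply]⟩,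
      fun h k => LinearMap.ext fun x => by
        rw [Module.End.mul_apply]
        change b ((h * k) • c x) = b (h • c (b (k • c x)))
        rw [hcb, mul_smul]⟩
  have hσ : ∀ h x, σ h x = b (h • c x) := fun _ _ => rfl
  obtain ⟨g, hg⟩ := exists_surjective_equivariantHom (F := F) hH σ fun V _ _ _ _ ρ hρ => by
    refine le_trans ?_ (hrank V ρ hρ)
    let l : IntertwiningMap σ ρ →ₗ[ZMod p] equivariantHoms Q ρ :=
      { toFun := fun φ => ⟨fun q => φ (b q), continuous_of_discreteTopology,
          fun q r => (congrArg φ (hb q r)).trans (map_add φ _ _),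
          fun h q => by
            change φ (b (h • q)) = ρ h (φ (b q))
            rw [← IntertwiningMap.isIntertwining, hσ, hcb]⟩
        map_add' := fun _ _ => rfl
        map_smul' := fun _ _ => rfl }
    refine LinearMap.rank_le_of_injective l fun φ ψ h => DFunLike.ext _ _ fun x => ?_
    have h' : φ (b (c x)) = ψ (b (c x)) := congr(($h).1 (c x))
    rwa [hbc] at h'
  refine ⟨⟨MonoidHom.mk' (fun x => c (g.1 x)) fun x y => ?_,
    (continuous_of_discreteTopology (f := c)).comp g.2.1⟩, fun h x => ?_, fun q => ?_⟩
  · rw [g.2.2.1, hc]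
  · change c (g.1 (h • x)) = h • c (g.1 x)
    rw [g.2.2.2, hσ, hcb]
  · obtain ⟨x, hx⟩ := hg (b q)
    exact ⟨x, (congrArg c hx).trans (hcb q)⟩

end

/-! ### The equivalence -/

theorem mainTheorem3 {p : ℕ} [Fact p.Prime] {γ : ℕ}
    {H : Type u} [Group H] [Finite H] [TopologicalSpace H] [DiscreteTopology H]
    (hH : ¬ p ∣ Nat.card H)
    {F : Type u} [Group F] [TopologicalSpace F] [IsTopologicalGroup F]
    (hF : IsFreeProP p γ F) [MulDistribMulAction H F] [ContinuousSMul H F]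
    {P : Type u} [Group P] [Finite P] [TopologicalSpace P] [DiscreteTopology P]
    (hP : IsPGroup p P) [MulDistribMulAction H P] :
    (∃ f : F →ₜ* P, (∀ (h : H) (x : F), f (h • x) = h • f x) ∧ Function.Surjective f) ↔
      ∀ (V : Type u) [AddCommGroup V] [Module (ZMod p) V] [TopologicalSpace V]
        [DiscreteTopology V] (ρ : Representation (ZMod p) H V), ρ.IsIrreducible →
        dimH1 P ρ ≤ dimH1 F ρ := by
  constructor
  · rintro ⟨f, hfH, hf⟩ V _ _ _ _ ρ -
    rw [dimH1_eq_rank_equivariantHoms ρ hH, dimH1_eq_rank_equivariantHoms ρ hH]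
    exact rank_equivariantHoms_le_of_surjective ρ f hfH hf
  · intro hdim
    have hW : ∀ (h : H), ∀ q ∈ frattini P, h • q ∈ frattini P := fun h q hq =>
      (SetLike.ext_iff.1 (Subgroup.characteristic_iff_comap_eq.1 frattini_characteristic
        (MulDistribMulAction.toMulEquiv P h)) q).2 hq
    let := QuotientGroup.mulDistribMulActionOfStable (frattini P) hW
    have : DiscreteTopology (P ⧸ frattini P) := QuotientGroup.discreteTopology (isOpen_discrete _)
    let π : P →ₜ* P ⧸ frattini P :=
      ⟨QuotientGroup.mk' (frattini P), continuous_of_discreteTopology⟩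
    have hπ : Function.Surjective π := QuotientGroup.mk'_surjective _
    let : AddCommGroup (Additive (P ⧸ frattini P)) :=
      { (inferInstance : AddGroup (Additive (P ⧸ frattini P))) with
        add_comm := fun x y => hP.frattini_quotient_mul_comm x.toMul y.toMul }
    let : Module (ZMod p) (Additive (P ⧸ frattini P)) :=
      AddCommGroup.zmodModule fun x => hP.frattini_quotient_pow_eq_one x.toMul
    let β : P ⧸ frattini P ≃* Multiplicative (Additive (P ⧸ frattini P)) :=
      { Equiv.refl _ with map_mul' := fun _ _ => rfl }
    obtain ⟨g, hgH, hg⟩ := exists_surjective_of_mulEquiv_multiplicative (F := F) hH β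
      fun V _ _ _ _ ρ hρ => by
        refine (rank_equivariantHoms_le_of_surjective ρ π (fun _ _ => rfl) hπ).trans ?_
        rw [← dimH1_eq_rank_equivariantHoms ρ hH, ← dimH1_eq_rank_equivariantHoms ρ hH]
        exact hdim V ρ hρ
    obtain ⟨f, hfH, hf⟩ := hF.exists_equivariant_lift hH hP (π : P →* P ⧸ frattini P) hπ
      (fun _ _ => rfl) g hgH
    -- It suffices that the image of `f` and the Frattini subgroup together generate `P`, which
    -- holds because `g` is onto.
    refine ⟨f, hfH, MonoidHom.range_eq_top (f := (f : F →* P)).1 (frattini_nongenerating ?_)⟩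
    refine eq_top_iff.2 fun y _ => ?_
    obtain ⟨x, hx⟩ := hg (π y)
    have hxy : (f x)⁻¹ * y ∈ frattini P := by
      rw [← QuotientGroup.eq]
      exact (hf x).trans hx
    rw [← mul_inv_cancel_left (f x) y]
    exact Subgroup.mul_mem_sup ⟨x, rfl⟩ hxy
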